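/- Let $G=(V,E)$ be a finite simple graph, let $p_e\in[0,1]$ for $e\in E$, and let $T\ge 0$ be a number of rounds with weights $w_1,\dots,w_T\ge 0$. Each edge $e$ is compatible with probability $p_e$, independently of the other edges; let $R\subseteq E$ be the random set of compatible edges, which is fixed once and for all. The probabilities $p_e$ are known, $R$ is not. In each round $t=1,\dots,T$ an online algorithm selects a matching $M_t$ of $G$ and then observes $M_t\cap R$; the choice of $M_t$ may depend on everything observed in rounds $1,\dots,t-1$ (and on random bits independent of $R$), and edges found compatible need not be selected again. The expected reward of the algorithm is $\mathbb E\big[\sum_{t=1}^T w_t\,|M_t\cap R|\big]$. The stable matching process SM is the following online algorithm. In each round it selects all edges that it has found compatible in earlier rounds, and then matches the agents not covered by these edges greedily: as long as two remaining agents are joined by an edge of positive current success probability, it adds an edge of the largest current success probability between two remaining agents and removes its two endpoints; ties are broken arbitrarily, and when all edges between remaining agents have current success probability $0$ it may add further such edges or stop. Here the current success probability of an edge is $p_e$ if SM has not selected $e$ before, and $0$ if $e$ has been selected and found incompatible. Then for every way of breaking ties, the expected reward of SM is at least $0.316$ times the expected reward of every online algorithm, in particular of an optimal one. -/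

import Mathlib

/-! Repeated stochastic matching on a finite graph with persistent edge compatibilities. -/

namespace RepeatedMatching

variable {V : Type*}

/-- What has been observed so far, in chronological order: for each past round, the set of edges
selected in that round, and the set of those among them that turned out to be successful. -/
abbrev History (V : Type*) := List (Finset (Sym2 V) × Finset (Sym2 V))

/-- `M` is a matching in `G`: a set of edges of `G`, no two of which share an endpoint. -/
def IsMatching (G : SimpleGraph V) (M : Finset (Sym2 V)) : Prop :=
  (∀ e ∈ M, e ∈ G.edgeSet) ∧ ∀ e ∈ M, ∀ f ∈ M, e ≠ f → ∀ v, v ∈ e → v ∉ f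

/-- A deterministic online algorithm selects in every round a matching of `G`, adaptively, as a
function of the history observed so far.  There is no obligation to keep successful edges. -/
structure OnlineAlgorithm (G : SimpleGraph V) where
  /-- the edges selected in the next round, given the history -/
  select : History V → Finset (Sym2 V)
  isMatching : ∀ h, IsMatching G (select h)

section
variable [DecidableEq V]

/-- All edges selected in the rounds of `h`. -/
def tested (h : History V) : Finset (Sym2 V) := (h.map Prod.fst).foldr (· ∪ ·) ∅

/-- All edges found successful in the rounds of `h`. -/
def successes (h : History V) : Finset (Sym2 V) := (h.map Prod.snd).foldr (· ∪ ·) ∅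

/-- The success probability of `e` given the history `h`: known successful edges stay successful,
known unsuccessful edges stay unsuccessful, and an edge not yet selected has its prior
probability. -/
def currentProb (p : Sym2 V → ℝ) (h : History V) (e : Sym2 V) : ℝ :=
  if e ∈ successes h then 1 else if e ∈ tested h then 0 else p e

/-- The history of the first `t` rounds when `a` is run and `R` is the set of compatible edges. -/
def history {G : SimpleGraph V} (a : OnlineAlgorithm G) (R : Finset (Sym2 V)) : ℕ → History V
  | 0 => []
  | t + 1 => history a R t ++
      [(a.select (history a R t), a.select (history a R t) ∩ R)]

/-- `GreedyMatching G q U N`: the set `N` is a possible outcome of the greedy procedure on the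
agents in `U` with edge weights `q`, which repeatedly pairs two remaining agents joined by an edge
of maximum weight (ties broken arbitrarily) and may stop once no two remaining agents are joined
by an edge of positive weight. -/
inductive GreedyMatching (G : SimpleGraph V) (q : Sym2 V → ℝ) :
    Set V → Finset (Sym2 V) → Prop
  | done (U : Set V) (hU : ∀ e ∈ G.edgeSet, (∀ v ∈ e, v ∈ U) → q e ≤ 0) :
      GreedyMatching G q U ∅
  | pick (U : Set V) (e : Sym2 V) (N : Finset (Sym2 V))
      (he : e ∈ G.edgeSet) (heU : ∀ v ∈ e, v ∈ U)
      (hmax : ∀ f ∈ G.edgeSet, (∀ v ∈ f, v ∈ U) → q f ≤ q e)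
      (hN : GreedyMatching G q {v | v ∈ U ∧ v ∉ e} N) :
      GreedyMatching G q U (insert e N)

/-- The agents not covered by an edge known to be successful. -/
def freeAgents (h : History V) : Set V := {v | ∀ e ∈ successes h, v ∉ e}

/-- `a` runs the stable matching process for `T` rounds: in each round, whatever the set `R` of
compatible edges, it keeps all pairs found successful so far and matches the remaining agents
greedily according to their current success probabilities. -/
def IsStableMatchingProcess {G : SimpleGraph V} (p : Sym2 V → ℝ) (T : ℕ)
    (a : OnlineAlgorithm G) : Prop :=
  ∀ R : Finset (Sym2 V), (∀ e ∈ R, e ∈ G.edgeSet) → ∀ t < T,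
    ∃ N, GreedyMatching G (currentProb p (history a R t)) (freeAgents (history a R t)) N ∧
      a.select (history a R t) = successes (history a R t) ∪ N

/-- The number of successful edges selected by `a` in round `t` (rounds are `0, …, T - 1`). -/
def roundReward {G : SimpleGraph V} (a : OnlineAlgorithm G) (R : Finset (Sym2 V)) (t : ℕ) : ℕ :=
  (a.select (history a R t) ∩ R).card

section
variable [Fintype V] (G : SimpleGraph V) [DecidableRel G.Adj]

/-- The probability that the set of compatible edges is exactly `R ⊆ E(G)`, edges being compatible
independently with probabilities `p`. -/
def sampleProb (p : Sym2 V → ℝ) (R : Finset (Sym2 V)) : ℝ :=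
  (∏ e ∈ R, p e) * ∏ e ∈ G.edgeFinset \ R, (1 - p e)

/-- Expected `w`-weighted sum of the numbers of successful edges selected in rounds
`0, …, T - 1`. -/
def expectedReward (p : Sym2 V → ℝ) (T : ℕ) (w : ℕ → ℝ) (a : OnlineAlgorithm G) : ℝ :=
  ∑ R ∈ G.edgeFinset.powerset,
    sampleProb G p R * ∑ t ∈ Finset.range T, w t * (roundReward a R t : ℝ)

/-- Expected reward of a randomized algorithm, given as a distribution over deterministic ones
that is independent of the compatibilities.  (The sum converges, as rewards are bounded.) -/
noncomputable def randomizedReward (p : Sym2 V → ℝ) (T : ℕ) (w : ℕ → ℝ)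
    (A : PMF (OnlineAlgorithm G)) : ℝ :=
  ∑' a, (A a).toReal * expectedReward G p T w a

end

end

end RepeatedMatching

namespace RepeatedMatching

/-! Fix a deterministic SM run `a`, a competitor `b` and a round `t`; let `y` be the expected reward
of `b` in round `t` and `x i` the expected number of successes of `a` after `i` rounds. A success of
`b` either meets a success of `a` (at most two per success of `a`) or is an edge untested by `a`
between free agents (`roundReward_le`). Edges of the second kind lie among those tested by `b` in `t
+ 1` rounds, a set of maximum degree at most `t + 1`, so the greedy step of `a` collects at least `1
/ (2 * (t + 1))` of their total probability (`sum_missedEdges_le`). As an edge is tested before its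
status is known, expected successes equal expected sums of `p` (`expectation_card_inter`). Hence `y
≤ 2 * x i + 2 * (t + 1) * (x (i + 1) - x i)` for `i ≤ t`, which gives `x (t + 1) ≥ (1 - 1/e) * y /
2`; and `x (t + 1)` is the reward of SM in round `t`, because SM keeps its successes. Weighting
rounds and averaging over random bits finishes the proof. -/

theorem exists_mem_sym2 {V : Type*} (e : Sym2 V) : ∃ v, v ∈ e := by
  induction e using Sym2.ind with
  | _ a b => exact ⟨a, Sym2.mem_mk_left a b⟩

/-! ### Greedy matchings against edge sets of bounded degree -/

section Greedy

variable {V : Type*} [DecidableEq V]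

theorem IsMatching.card_filter_mem_le_one {G : SimpleGraph V} {M : Finset (Sym2 V)}
    (hM : IsMatching G M) (v : V) : (M.filter fun e => v ∈ e).card ≤ 1 := by
  rw [Finset.card_le_one]
  intro e he f hf
  rw [Finset.mem_filter] at he hf
  by_contra hne
  exact hM.2 e he.1 f hf.1 hne v he.2 hf.2

open Classical in
theorem card_filter_adjacent_le {S : Finset (Sym2 V)} {k : ℕ}
    (hS : ∀ v, (S.filter fun e => v ∈ e).card ≤ k) (f : Sym2 V) :
    (S.filter fun e => ∃ v ∈ f, v ∈ e).card ≤ 2 * k := by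
  induction f using Sym2.ind with
  | _ a b =>
    calc (S.filter fun e => ∃ v ∈ s(a, b), v ∈ e).card
        ≤ ((S.filter fun e => a ∈ e) ∪ (S.filter fun e => b ∈ e)).card := by
          apply Finset.card_le_card
          intro e he
          simp only [Finset.mem_filter, Finset.mem_union, Sym2.mem_iff] at he ⊢
          obtain ⟨heS, v, rfl | rfl, hv⟩ := he
          · exact Or.inl ⟨heS, hv⟩
          · exact Or.inr ⟨heS, hv⟩
      _ ≤ _ := Finset.card_union_le _ _
      _ ≤ 2 * k := by have := hS a; have := hS b; omega

theorem GreedyMatching.subset {G : SimpleGraph V} {q : Sym2 V → ℝ} {U : Set V}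
    {N : Finset (Sym2 V)} (h : GreedyMatching G q U N) :
    ∀ e ∈ N, ∀ v ∈ e, v ∈ U := by
  induction h with
  | done U hU => simp
  | pick U e N he heU hmax hN ih =>
    intro f hf v hv
    rw [Finset.mem_insert] at hf
    rcases hf with rfl | hf
    · exact heU v hv
    · exact (ih f hf v hv).1

open Classical in
-- Charge each edge of `S` to the first greedy edge that meets it: it was still available then, so
-- it weighs no more, and each greedy edge is charged at most `2 * k` times.
theorem GreedyMatching.sum_le {G : SimpleGraph V} {q : Sym2 V → ℝ}
    (hq : ∀ e ∈ G.edgeSet, 0 ≤ q e) {k : ℕ} {U : Set V}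
    {N : Finset (Sym2 V)} (h : GreedyMatching G q U N) :
    ∀ S : Finset (Sym2 V), (∀ e ∈ S, e ∈ G.edgeSet) → (∀ e ∈ S, ∀ v ∈ e, v ∈ U) →
      (∀ v, (S.filter fun e => v ∈ e).card ≤ k) →
      ∑ e ∈ S, q e ≤ 2 * k * ∑ f ∈ N, q f := by
  induction h with
  | done U hU =>
    intro S hSG hSU _
    simpa using Finset.sum_nonpos fun e he => hU e (hSG e he) (hSU e he)
  | pick U e N he heU hmax hN ih =>
    intro S hSG hSU hSk
    have heN : e ∉ N := fun heN => by
      obtain ⟨v, hv⟩ := exists_mem_sym2 e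
      exact (hN.subset e heN v hv).2 hv
    rw [Finset.sum_insert heN, ← Finset.sum_filter_add_sum_filter_not S (fun f => ∃ v ∈ e, v ∈ f),
      mul_add]
    refine add_le_add ?_ ?_
    · calc ∑ f ∈ S.filter (fun f => ∃ v ∈ e, v ∈ f), q f
          ≤ (S.filter (fun f => ∃ v ∈ e, v ∈ f)).card • q e :=
            Finset.sum_le_card_nsmul _ _ _ fun f hf => by
              have hfS := (Finset.mem_filter.1 hf).1
              exact hmax f (hSG f hfS) (hSU f hfS)
        _ ≤ 2 * k * q e := by
            rw [nsmul_eq_mul]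
            refine mul_le_mul_of_nonneg_right ?_ (hq e he)
            exact_mod_cast card_filter_adjacent_le hSk e
    · refine ih _ (fun f hf => hSG f (Finset.mem_filter.1 hf).1) (fun f hf v hv => ?_)
        fun v => (Finset.card_le_card ?_).trans (hSk v)
      · rw [Finset.mem_filter] at hf
        exact ⟨hSU f hf.1 v hv, fun hve => hf.2 ⟨v, hve, hv⟩⟩
      · exact Finset.filter_subset_filter _ (Finset.filter_subset _ _)

end Greedy

/-! ### Histories and their dependence on a single edge -/

section History

variable {V : Type*} [DecidableEq V]

theorem mem_tested {h : History V} {e : Sym2 V} : e ∈ tested h ↔ ∃ x ∈ h, e ∈ x.1 := by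
  induction h with
  | nil => simp [tested]
  | cons x h ih =>
    have : tested (x :: h) = x.1 ∪ tested h := rfl
    simp [this, ih]

theorem mem_successes {h : History V} {e : Sym2 V} : e ∈ successes h ↔ ∃ x ∈ h, e ∈ x.2 := by
  induction h with
  | nil => simp [successes]
  | cons x h ih =>
    have : successes (x :: h) = x.2 ∪ successes h := rfl
    simp [this, ih]

variable {G : SimpleGraph V} (a : OnlineAlgorithm G) (R : Finset (Sym2 V))

theorem tested_history_succ (t : ℕ) : tested (history a R (t + 1)) =
    tested (history a R t) ∪ a.select (history a R t) := by
  ext e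
  simp only [history, mem_tested, List.mem_append, List.mem_singleton, Finset.mem_union]
  grind

theorem successes_history_succ (t : ℕ) : successes (history a R (t + 1)) =
    successes (history a R t) ∪ (a.select (history a R t) ∩ R) := by
  ext e
  simp only [history, mem_successes, List.mem_append, List.mem_singleton, Finset.mem_union]
  grind

theorem successes_history (t : ℕ) :
    successes (history a R t) = tested (history a R t) ∩ R := by
  induction t with
  | zero => simp [history, successes, tested]
  | succ t ih =>
    rw [successes_history_succ, tested_history_succ, ih, Finset.union_inter_distrib_right]

theorem mem_edgeSet_of_mem_tested {t : ℕ} {e : Sym2 V} (he : e ∈ tested (history a R t)) :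
    e ∈ G.edgeSet := by
  induction t with
  | zero => simp [history, tested] at he
  | succ t ih =>
    rw [tested_history_succ, Finset.mem_union] at he
    exact he.elim ih ((a.isMatching _).1 e)

theorem card_filter_tested_le (t : ℕ) (v : V) :
    ((tested (history a R t)).filter fun e => v ∈ e).card ≤ t := by
  induction t with
  | zero => simp [history, tested]
  | succ t ih =>
    rw [tested_history_succ, Finset.filter_union]
    exact (Finset.card_union_le _ _).trans
      (add_le_add ih ((a.isMatching _).card_filter_mem_le_one v))

/-- The status of an edge cannot influence a run before the edge is selected. -/
theorem history_insert {e : Sym2 V} {t : ℕ} (he : e ∉ tested (history a R t)) :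
    history a (insert e R) t = history a R t := by
  induction t with
  | zero => rfl
  | succ t ih =>
    rw [tested_history_succ, Finset.mem_union, not_or] at he
    simp only [history]
    rw [ih he.1, Finset.inter_insert_of_notMem he.2]

theorem mem_tested_history_insert {e : Sym2 V} {t : ℕ} :
    e ∈ tested (history a (insert e R) t) ↔ e ∈ tested (history a R t) := by
  constructor
  · intro h
    by_contra hn
    rw [history_insert a R hn] at h
    exact hn h
  · intro h
    induction t with
    | zero => simp [history, tested] at h
    | succ t ih =>
      by_cases h1 : e ∈ tested (history a R t)
      · rw [tested_history_succ]
        exact Finset.mem_union_left _ (ih h1)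
      · rw [tested_history_succ] at h ⊢
        rwa [history_insert a R h1]

end History

/-! ### Comparison of two runs for a fixed compatible set -/

section Pathwise

variable {V : Type*} [DecidableEq V] {G : SimpleGraph V}

/-- The edges that are selected for the first time in round `t`. -/
def freshEdges (a : OnlineAlgorithm G) (t : ℕ) (R : Finset (Sym2 V)) : Finset (Sym2 V) :=
  a.select (history a R t) \ tested (history a R t)

open Classical in
/-- The edges selected by `b` in its first `k` rounds that `a` has not selected in its first `i`
rounds and whose endpoints are not covered by successes of `a`. -/
noncomputable def missedEdges (a b : OnlineAlgorithm G) (i k : ℕ) (R : Finset (Sym2 V)) :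
    Finset (Sym2 V) :=
  (tested (history b R k)).filter fun e =>
    e ∉ tested (history a R i) ∧ ∀ v ∈ e, v ∈ freeAgents (history a R i)

theorem mem_missedEdges {a b : OnlineAlgorithm G} {i k : ℕ} {R : Finset (Sym2 V)} {e : Sym2 V} :
    e ∈ missedEdges a b i k R ↔ e ∈ tested (history b R k) ∧
      e ∉ tested (history a R i) ∧ ∀ v ∈ e, v ∈ freeAgents (history a R i) := by
  simp [missedEdges]

theorem mem_freshEdges_insert (a : OnlineAlgorithm G) (t : ℕ) (R : Finset (Sym2 V)) (e : Sym2 V) :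
    e ∈ freshEdges a t (insert e R) ↔ e ∈ freshEdges a t R := by
  by_cases h : e ∈ tested (history a R t)
  · simp [freshEdges, mem_tested_history_insert, h]
  · simp [freshEdges, history_insert a R h]

theorem mem_missedEdges_insert (a b : OnlineAlgorithm G) (i k : ℕ) (R : Finset (Sym2 V))
    (e : Sym2 V) : e ∈ missedEdges a b i k (insert e R) ↔ e ∈ missedEdges a b i k R := by
  by_cases h : e ∈ tested (history a R i)
  · simp [missedEdges, mem_tested_history_insert, h]
  · simp [missedEdges, mem_tested_history_insert, history_insert a R h]

theorem card_successes_add_card_fresh_le (a : OnlineAlgorithm G) (t : ℕ) (R : Finset (Sym2 V)) :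
    (successes (history a R t)).card + (freshEdges a t R ∩ R).card ≤
      (successes (history a R (t + 1))).card := by
  rw [← Finset.card_union_of_disjoint]
  · apply Finset.card_le_card
    rw [successes_history_succ]
    exact Finset.union_subset_union_right
      (Finset.inter_subset_inter_right Finset.sdiff_subset)
  · rw [successes_history, Finset.disjoint_left]
    intro e he he'
    simp only [freshEdges, Finset.mem_inter, Finset.mem_sdiff] at he he'
    exact he'.1.2 he.1

open Classical in
theorem roundReward_le (a b : OnlineAlgorithm G) (i t : ℕ) (R : Finset (Sym2 V)) :
    roundReward b R t ≤ 2 * (successes (history a R i)).card +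
      (missedEdges a b i (t + 1) R ∩ R).card := by
  have hM := b.isMatching (history b R t)
  set M := b.select (history b R t) with hMdef
  set A := successes (history a R i) with hA
  have hsub : M ∩ R ⊆ (A.biUnion fun f => M.filter fun e => ∃ v ∈ f, v ∈ e) ∪
      (missedEdges a b i (t + 1) R ∩ R) := by
    intro e he
    rw [Finset.mem_inter] at he
    rw [Finset.mem_union]
    by_cases hfree : ∀ v ∈ e, v ∈ freeAgents (history a R i)
    · right
      rw [Finset.mem_inter, mem_missedEdges]
      refine ⟨⟨?_, fun ht => ?_, hfree⟩, he.2⟩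
      · rw [tested_history_succ]
        exact Finset.mem_union_right _ he.1
      -- A compatible edge tested by `a` would be a success covering its own endpoints.
      · obtain ⟨v, hv⟩ := exists_mem_sym2 e
        exact hfree v hv e (by rw [successes_history]; exact Finset.mem_inter.2 ⟨ht, he.2⟩) hv
    · left
      push Not at hfree
      obtain ⟨v, hve, hv⟩ := hfree
      simp only [freeAgents, Set.mem_ofPred_eq, not_forall, not_not] at hv
      obtain ⟨f, hf, hvf⟩ := hv
      rw [Finset.mem_biUnion]
      exact ⟨f, hf, Finset.mem_filter.2 ⟨he.1, v, hvf, hve⟩⟩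
  calc roundReward b R t = (M ∩ R).card := rfl
    _ ≤ _ := (Finset.card_le_card hsub).trans (Finset.card_union_le _ _)
    _ ≤ _ := by
      refine Nat.add_le_add_right ?_ _
      rw [mul_comm]
      exact Finset.card_biUnion_le_card_mul _ _ _ fun f _ => by
        simpa using card_filter_adjacent_le hM.card_filter_mem_le_one f

theorem sum_missedEdges_le {p : Sym2 V → ℝ} (hp : ∀ e ∈ G.edgeSet, 0 ≤ p e ∧ p e ≤ 1) {T : ℕ}
    {a : OnlineAlgorithm G} (ha : IsStableMatchingProcess p T a) (b : OnlineAlgorithm G)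
    {i : ℕ} (hi : i < T) (k : ℕ) {R : Finset (Sym2 V)} (hR : ∀ e ∈ R, e ∈ G.edgeSet) :
    ∑ e ∈ missedEdges a b i k R, p e ≤ 2 * k * ∑ e ∈ freshEdges a i R, p e := by
  obtain ⟨N, hN, hsel⟩ := ha R hR i hi
  set h := history a R i with hh
  have hst : successes h ⊆ tested h := by
    rw [hh, successes_history]
    exact Finset.inter_subset_left
  have hq : ∀ e ∈ G.edgeSet, 0 ≤ currentProb p h e := by
    intro e he
    unfold currentProb
    split_ifs
    exacts [zero_le_one, le_rfl, (hp e he).1]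
  have hqp : ∀ e, e ∉ tested h → currentProb p h e = p e := fun e he => by
    rw [currentProb, if_neg fun hs => he (hst hs), if_neg he]
  have hNs : ∀ e ∈ N, e ∉ successes h := fun e he hs => by
    obtain ⟨v, hv⟩ := exists_mem_sym2 e
    exact hN.subset e he v hv e hs hv
  -- Greedy may also pick edges known to fail, but these have weight `0`.
  have hfresh : ∑ e ∈ freshEdges a i R, p e = ∑ e ∈ N, currentProb p h e := by
    have hsub : freshEdges a i R ⊆ N := by
      intro e he
      rw [freshEdges, ← hh, hsel, Finset.mem_sdiff, Finset.mem_union] at he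
      exact he.1.resolve_left fun hs => he.2 (hst hs)
    rw [← Finset.sum_subset hsub]
    · refine Finset.sum_congr rfl fun e he => (hqp e ?_).symm
      exact (Finset.mem_sdiff.1 he).2
    · intro e heN he
      have ht : e ∈ tested h := by
        by_contra ht
        refine he (Finset.mem_sdiff.2 ⟨?_, ht⟩)
        rw [← hh, hsel]
        exact Finset.mem_union_right _ heN
      rw [currentProb, if_neg (hNs e heN), if_pos ht]
  rw [hfresh, Finset.sum_congr rfl fun e (he : e ∈ missedEdges a b i k R) =>
    (hqp e (mem_missedEdges.1 he).2.1).symm]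
  refine hN.sum_le hq _ (fun e he => ?_) (fun e he => (mem_missedEdges.1 he).2.2) fun v => ?_
  · exact mem_edgeSet_of_mem_tested b R (mem_missedEdges.1 he).1
  · exact (Finset.card_le_card (Finset.filter_subset_filter _ fun e he =>
      (mem_missedEdges.1 he).1)).trans
      (card_filter_tested_le b R k v)

theorem IsStableMatchingProcess.roundReward_eq {p : Sym2 V → ℝ} {T : ℕ} {a : OnlineAlgorithm G}
    (ha : IsStableMatchingProcess p T a) {t : ℕ} (ht : t < T) {R : Finset (Sym2 V)}
    (hR : ∀ e ∈ R, e ∈ G.edgeSet) :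
    roundReward a R t = (successes (history a R (t + 1))).card := by
  obtain ⟨N, -, hsel⟩ := ha R hR t ht
  rw [roundReward, successes_history_succ]
  congr 1
  refine (Finset.union_eq_right.2 fun e he => Finset.mem_inter.2 ⟨?_, ?_⟩).symm
  · rw [hsel]
    exact Finset.mem_union_left _ he
  · rw [successes_history] at he
    exact (Finset.mem_inter.1 he).2

end Pathwise

/-! ### Expectations, the recursion and the constant -/

section Expectation

variable {V : Type*} [DecidableEq V] [Fintype V] (G : SimpleGraph V) [DecidableRel G.Adj]
  (p : Sym2 V → ℝ)

/-- The expectation of a function of the random set of compatible edges. -/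
def expectation (F : Finset (Sym2 V) → ℝ) : ℝ :=
  ∑ R ∈ G.edgeFinset.powerset, sampleProb G p R * F R

variable {G p}

theorem sampleProb_nonneg (hp : ∀ e ∈ G.edgeSet, 0 ≤ p e ∧ p e ≤ 1) {R : Finset (Sym2 V)}
    (hR : R ⊆ G.edgeFinset) : 0 ≤ sampleProb G p R := by
  refine mul_nonneg (Finset.prod_nonneg fun e he => ?_) (Finset.prod_nonneg fun e he => ?_)
  · exact (hp e (SimpleGraph.mem_edgeFinset.1 (hR he))).1
  · exact sub_nonneg.2 (hp e (SimpleGraph.mem_edgeFinset.1 (Finset.mem_sdiff.1 he).1)).2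

theorem expectation_mono (hp : ∀ e ∈ G.edgeSet, 0 ≤ p e ∧ p e ≤ 1)
    {F F' : Finset (Sym2 V) → ℝ} (h : ∀ R, (∀ e ∈ R, e ∈ G.edgeSet) → F R ≤ F' R) :
    expectation G p F ≤ expectation G p F' := by
  refine Finset.sum_le_sum fun R hR => ?_
  rw [Finset.mem_powerset] at hR
  exact mul_le_mul_of_nonneg_left (h R fun e he => SimpleGraph.mem_edgeFinset.1 (hR he))
    (sampleProb_nonneg hp hR)

theorem expectation_add (F F' : Finset (Sym2 V) → ℝ) :
    expectation G p (fun R => F R + F' R) = expectation G p F + expectation G p F' := by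
  simp [expectation, mul_add, Finset.sum_add_distrib]

theorem expectation_const_mul (c : ℝ) (F : Finset (Sym2 V) → ℝ) :
    expectation G p (fun R => c * F R) = c * expectation G p F := by
  simp only [expectation, Finset.mul_sum]
  exact Finset.sum_congr rfl fun R _ => by ring

theorem expectation_sum {ι : Type*} (s : Finset ι) (F : ι → Finset (Sym2 V) → ℝ) :
    expectation G p (fun R => ∑ j ∈ s, F j R) = ∑ j ∈ s, expectation G p (F j) := by
  simp only [expectation, Finset.mul_sum]
  exact Finset.sum_comm

theorem expectation_ite_mem {e : Sym2 V} (he : e ∈ G.edgeFinset) {F : Finset (Sym2 V) → ℝ}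
    (hF : ∀ R, F (insert e R) = F R) :
    expectation G p (fun R => if e ∈ R then F R else 0) = p e * expectation G p F := by
  have hnot : ∀ R ∈ (G.edgeFinset.erase e).powerset, e ∉ R := fun R hR h =>
    Finset.notMem_erase e _ (Finset.mem_powerset.1 hR h)
  have hins : ∀ R ∈ (G.edgeFinset.erase e).powerset, sampleProb G p (insert e R) =
      p e * ((∏ f ∈ R, p f) * ∏ f ∈ G.edgeFinset.erase e \ R, (1 - p f)) := fun R hR => by
    rw [sampleProb, Finset.prod_insert (hnot R hR), mul_assoc]
    have : G.edgeFinset \ insert e R = G.edgeFinset.erase e \ R := by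
      ext f
      simp only [Finset.mem_sdiff, Finset.mem_insert, Finset.mem_erase]
      tauto
    rw [this]
  have hout : ∀ R ∈ (G.edgeFinset.erase e).powerset, sampleProb G p R =
      (1 - p e) * ((∏ f ∈ R, p f) * ∏ f ∈ G.edgeFinset.erase e \ R, (1 - p f)) := fun R hR => by
    have : G.edgeFinset \ R = insert e (G.edgeFinset.erase e \ R) := by
      ext f
      have := hnot R hR
      by_cases hfe : f = e
      · subst hfe; simp [this, SimpleGraph.mem_edgeFinset.1 he]
      · simp [hfe]
    rw [sampleProb, this, Finset.prod_insert (by simp)]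
    ring
  have hsplit : ∀ H : Finset (Sym2 V) → ℝ, ∑ R ∈ G.edgeFinset.powerset, H R =
      ∑ R ∈ (G.edgeFinset.erase e).powerset, (H R + H (insert e R)) := fun H => by
    rw [Finset.sum_add_distrib, ← Finset.sum_powerset_insert (Finset.notMem_erase e _),
      Finset.insert_erase he]
  rw [expectation, expectation, hsplit, hsplit, Finset.mul_sum]
  refine Finset.sum_congr rfl fun R hR => ?_
  rw [hins R hR, hout R hR, hF, if_neg (hnot R hR), if_pos (Finset.mem_insert_self e R)]
  ring

/-- By `hins` the events `e ∈ S R` and `e ∈ R` are independent; sum over edges. The set selected in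
one round need not satisfy `hins`, which is why `missedEdges` collects all tested edges. -/
theorem expectation_card_inter {S : Finset (Sym2 V) → Finset (Sym2 V)}
    (hS : ∀ R, ∀ e ∈ S R, e ∈ G.edgeSet) (hins : ∀ R e, e ∈ S (insert e R) ↔ e ∈ S R) :
    expectation G p (fun R => ((S R ∩ R).card : ℝ)) =
      expectation G p (fun R => ∑ e ∈ S R, p e) := by
  have hfilter : ∀ R, G.edgeFinset.filter (fun e => e ∈ S R) = S R := fun R => by
    ext e
    simp only [Finset.mem_filter, SimpleGraph.mem_edgeFinset, and_iff_right_iff_imp]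
    exact hS R e
  have h1 : ∀ R, ((S R ∩ R).card : ℝ) =
      ∑ e ∈ G.edgeFinset, if e ∈ R then (if e ∈ S R then (1 : ℝ) else 0) else 0 := fun R => by
    have : S R ∩ R = G.edgeFinset.filter (fun e => e ∈ R ∧ e ∈ S R) := by
      ext e
      simp only [Finset.mem_filter, SimpleGraph.mem_edgeFinset, Finset.mem_inter]
      exact ⟨fun h => ⟨hS R e h.1, h.2, h.1⟩, fun h => ⟨h.2.2, h.2.1⟩⟩
    simp_rw [this, ← ite_and, Finset.sum_boole]
  have h2 : ∀ R, ∑ e ∈ S R, p e =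
      ∑ e ∈ G.edgeFinset, p e * if e ∈ S R then (1 : ℝ) else 0 := fun R => by
    simp_rw [mul_ite, mul_one, mul_zero, ← Finset.sum_filter, hfilter]
  simp_rw [h1, h2, expectation_sum, expectation_const_mul]
  exact Finset.sum_congr rfl fun e he => expectation_ite_mem he fun R => by
    simp only [hins]

theorem expectation_roundReward_le (hp : ∀ e ∈ G.edgeSet, 0 ≤ p e ∧ p e ≤ 1) {T : ℕ}
    {a : OnlineAlgorithm G} (ha : IsStableMatchingProcess p T a) (b : OnlineAlgorithm G)
    {i : ℕ} (hi : i < T) (t : ℕ) :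
    expectation G p (fun R => (roundReward b R t : ℝ)) ≤
      2 * expectation G p (fun R => ((successes (history a R i)).card : ℝ)) +
      2 * (t + 1 : ℕ) * (expectation G p (fun R => ((successes (history a R (i + 1))).card : ℝ)) -
        expectation G p (fun R => ((successes (history a R i)).card : ℝ))) := by
  have hA : expectation G p (fun R => (roundReward b R t : ℝ)) ≤
      2 * expectation G p (fun R => ((successes (history a R i)).card : ℝ)) +
      expectation G p (fun R => ((missedEdges a b i (t + 1) R ∩ R).card : ℝ)) := by
    rw [← expectation_const_mul, ← expectation_add]
    exact expectation_mono hp fun R _ => by exact_mod_cast roundReward_le a b i t R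
  have hB : expectation G p (fun R => ((missedEdges a b i (t + 1) R ∩ R).card : ℝ)) ≤
      2 * (t + 1 : ℕ) * expectation G p (fun R => ((freshEdges a i R ∩ R).card : ℝ)) := by
    rw [expectation_card_inter (fun R e he =>
        mem_edgeSet_of_mem_tested b R (mem_missedEdges.1 he).1)
        (mem_missedEdges_insert a b i (t + 1)),
      expectation_card_inter (S := freshEdges a i) (fun R e he => (a.isMatching _).1 e (Finset.mem_sdiff.1 he).1)
        (mem_freshEdges_insert a i), ← expectation_const_mul]
    exact expectation_mono hp fun R hR => sum_missedEdges_le hp ha b hi (t + 1) hR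
  have hC : expectation G p (fun R => ((successes (history a R i)).card : ℝ)) +
      expectation G p (fun R => ((freshEdges a i R ∩ R).card : ℝ)) ≤
      expectation G p (fun R => ((successes (history a R (i + 1))).card : ℝ)) := by
    rw [← expectation_add]
    exact expectation_mono hp fun R _ => by exact_mod_cast card_successes_add_card_fresh_le a i R
  refine hA.trans (add_le_add_right (hB.trans ?_) _)
  exact mul_le_mul_of_nonneg_left (by linarith) (by positivity)

/-- Each step multiplies the deficit `y / 2 - x i` by at most `1 - 1 / k`. -/
theorem one_sub_pow_mul_le_of_recursion {x : ℕ → ℝ} {y : ℝ} {k : ℕ} (hk : 0 < k) (h0 : 0 ≤ x 0)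
    (h : ∀ i < k, y ≤ 2 * x i + 2 * k * (x (i + 1) - x i)) :
    (1 - (1 - 1 / (k : ℝ)) ^ k) * (y / 2) ≤ x k := by
  have hk' : (1 : ℝ) ≤ k := by exact_mod_cast hk
  have hr : 0 ≤ 1 - 1 / (k : ℝ) := by
    rw [sub_nonneg, div_le_one (by linarith)]
    exact hk'
  have key : ∀ i ≤ k, y / 2 - x i ≤ (1 - 1 / (k : ℝ)) ^ i * (y / 2) := by
    intro i
    induction i with
    | zero => intro _; simpa using h0
    | succ i ih =>
      intro hi
      have hstep : (y / 2 - x i) / k ≤ x (i + 1) - x i := by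
        rw [div_le_iff₀ (by linarith)]
        linarith [h i hi]
      calc y / 2 - x (i + 1) ≤ (1 - 1 / (k : ℝ)) * (y / 2 - x i) := by
            have : (1 - 1 / (k : ℝ)) * (y / 2 - x i) =
              (y / 2 - x i) - (y / 2 - x i) / k := by ring
            linarith
        _ ≤ (1 - 1 / (k : ℝ)) * ((1 - 1 / (k : ℝ)) ^ i * (y / 2)) :=
            mul_le_mul_of_nonneg_left (ih (by omega)) hr
        _ = _ := by ring
  linarith [key k le_rfl]

theorem one_sub_one_div_pow_le {k : ℕ} (hk : 0 < k) : (1 - 1 / (k : ℝ)) ^ k ≤ 0.368 := by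
  have h1 : (1 - 1 / (k : ℝ)) ^ k ≤ Real.exp (-1) :=
    Real.one_sub_div_pow_le_exp_neg (by exact_mod_cast hk)
  have h2 : Real.exp (-1) ≤ 0.368 := by
    rw [Real.exp_neg, inv_le_comm₀ (Real.exp_pos 1) (by norm_num)]
    exact le_trans (by norm_num) Real.exp_one_gt_d9.le
  exact h1.trans h2

theorem expectation_roundReward_stable_ge (hp : ∀ e ∈ G.edgeSet, 0 ≤ p e ∧ p e ≤ 1) {T : ℕ}
    {a : OnlineAlgorithm G} (ha : IsStableMatchingProcess p T a) (b : OnlineAlgorithm G)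
    {t : ℕ} (ht : t < T) :
    0.316 * expectation G p (fun R => (roundReward b R t : ℝ)) ≤
      expectation G p (fun R => (roundReward a R t : ℝ)) := by
  have hnonneg : ∀ F : Finset (Sym2 V) → ℕ, 0 ≤ expectation G p (fun R => (F R : ℝ)) := fun F =>
    Finset.sum_nonneg fun R hR =>
      mul_nonneg (sampleProb_nonneg hp (Finset.mem_powerset.1 hR)) (Nat.cast_nonneg _)
  -- Here `t + 1` is both the degree bound for `b` and the number of rounds of `a` up to and
  -- including round `t`.
  have hrec := one_sub_pow_mul_le_of_recursion (k := t + 1)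
    (x := fun i => expectation G p (fun R => ((successes (history a R i)).card : ℝ)))
    t.succ_pos (hnonneg _)
    fun i hi => expectation_roundReward_le hp ha b (show i < T by omega) t
  have hpow := one_sub_one_div_pow_le t.succ_pos
  have hmul := mul_le_mul_of_nonneg_right hpow
    (div_nonneg (hnonneg fun R => roundReward b R t) two_pos.le)
  refine le_trans ?_ (hrec.trans (expectation_mono hp fun R hR => ?_))
  -- The constant is `(1 - 0.368) / 2 = 0.316`.
  · rw [Nat.succ_eq_add_one] at hmul
    rw [sub_mul]
    linarith
  · rw [ha.roundReward_eq ht hR]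

theorem expectedReward_eq (T : ℕ) (w : ℕ → ℝ) (a : OnlineAlgorithm G) :
    expectedReward G p T w a =
      ∑ t ∈ Finset.range T, w t * expectation G p (fun R => (roundReward a R t : ℝ)) := by
  simp_rw [← expectation_const_mul]
  rw [← expectation_sum]
  rfl

theorem expectedReward_stable_ge (hp : ∀ e ∈ G.edgeSet, 0 ≤ p e ∧ p e ≤ 1) {T : ℕ} {w : ℕ → ℝ}
    (hw : ∀ t < T, 0 ≤ w t) {a : OnlineAlgorithm G} (ha : IsStableMatchingProcess p T a)
    (b : OnlineAlgorithm G) :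
    0.316 * expectedReward G p T w b ≤ expectedReward G p T w a := by
  rw [expectedReward_eq, expectedReward_eq, Finset.mul_sum]
  refine Finset.sum_le_sum fun t ht => ?_
  rw [Finset.mem_range] at ht
  rw [mul_left_comm]
  exact mul_le_mul_of_nonneg_left (expectation_roundReward_stable_ge hp ha b ht) (hw t ht)

theorem expectedReward_nonneg (hp : ∀ e ∈ G.edgeSet, 0 ≤ p e ∧ p e ≤ 1) {T : ℕ} {w : ℕ → ℝ}
    (hw : ∀ t < T, 0 ≤ w t) (a : OnlineAlgorithm G) : 0 ≤ expectedReward G p T w a :=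
  Finset.sum_nonneg fun _ hR =>
    mul_nonneg (sampleProb_nonneg hp (Finset.mem_powerset.1 hR))
      (Finset.sum_nonneg fun t ht => mul_nonneg (hw t (Finset.mem_range.1 ht)) (Nat.cast_nonneg _))

theorem expectedReward_le (hp : ∀ e ∈ G.edgeSet, 0 ≤ p e ∧ p e ≤ 1) {T : ℕ} {w : ℕ → ℝ}
    (hw : ∀ t < T, 0 ≤ w t) (a : OnlineAlgorithm G) : expectedReward G p T w a ≤
      expectation G p fun R => ∑ t ∈ Finset.range T, w t * (R.card : ℝ) :=
  expectation_mono hp fun R _ => Finset.sum_le_sum fun t ht =>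
    mul_le_mul_of_nonneg_left (by exact_mod_cast Finset.card_le_card Finset.inter_subset_right)
      (hw t (Finset.mem_range.1 ht))

end Expectation

/-! ### Averaging over randomized algorithms -/

theorem hasSum_pmf_toReal {α : Type*} (A : PMF α) : HasSum (fun a => (A a).toReal) 1 := by
  have h := ENNReal.hasSum_toReal (f := A) (by simp [A.tsum_coe])
  rwa [← ENNReal.tsum_toReal_eq A.apply_ne_top, A.tsum_coe, ENNReal.toReal_one] at h

theorem summable_pmf_mul {α : Type*} (A : PMF α) {f : α → ℝ} {C : ℝ} (h0 : ∀ a, 0 ≤ f a)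
    (hC : ∀ a, f a ≤ C) : Summable fun a => (A a).toReal * f a :=
  Summable.of_nonneg_of_le (fun a => mul_nonneg ENNReal.toReal_nonneg (h0 a))
    (fun a => mul_le_mul_of_nonneg_left (hC a) ENNReal.toReal_nonneg)
    ((hasSum_pmf_toReal A).summable.mul_right C)

theorem tsum_pmf_mul_le {α : Type*} (A : PMF α) {f : α → ℝ} {C : ℝ} (h0 : ∀ a, 0 ≤ f a)
    (hC : ∀ a, f a ≤ C) : ∑' a, (A a).toReal * f a ≤ C := by
  have h := (summable_pmf_mul A h0 hC).tsum_le_tsum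
    (fun a => mul_le_mul_of_nonneg_left (hC a) ENNReal.toReal_nonneg)
    ((hasSum_pmf_toReal A).summable.mul_right C)
  rwa [tsum_mul_right, (hasSum_pmf_toReal A).tsum_eq, one_mul] at h

/-- The bound `C` only secures summability; without it `∑'` could default to `0`. -/
theorem le_tsum_pmf_mul {α : Type*} (A : PMF α) {f : α → ℝ} {c C : ℝ} (h0 : ∀ a, 0 ≤ f a)
    (hC : ∀ a, f a ≤ C) (hc : ∀ a ∈ A.support, c ≤ f a) : c ≤ ∑' a, (A a).toReal * f a := by
  have h := ((hasSum_pmf_toReal A).summable.mul_right c).tsum_le_tsum (fun a => ?_)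
    (summable_pmf_mul A h0 hC)
  · rwa [tsum_mul_right, (hasSum_pmf_toReal A).tsum_eq, one_mul] at h
  · by_cases ha : a ∈ A.support
    · exact mul_le_mul_of_nonneg_left (hc a ha) ENNReal.toReal_nonneg
    · rw [PMF.mem_support_iff, not_not] at ha
      simp [ha]

end RepeatedMatching

theorem theorem1 {V : Type*} [Fintype V] [DecidableEq V] (G : SimpleGraph V)
    [DecidableRel G.Adj] (p : Sym2 V → ℝ) (hp : ∀ e ∈ G.edgeSet, 0 ≤ p e ∧ p e ≤ 1)
    (T : ℕ) (SM : PMF (RepeatedMatching.OnlineAlgorithm G))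
    (hSM : ∀ a ∈ SM.support, RepeatedMatching.IsStableMatchingProcess p T a)
    (w : ℕ → ℝ) (hw : ∀ t < T, 0 ≤ w t)
    (OPT : PMF (RepeatedMatching.OnlineAlgorithm G)) :
    0.316 * RepeatedMatching.randomizedReward G p T w OPT ≤
      RepeatedMatching.randomizedReward G p T w SM := by
  have hb : ∀ a ∈ SM.support, 0.316 * RepeatedMatching.randomizedReward G p T w OPT ≤
      RepeatedMatching.expectedReward G p T w a := by
    intro a ha
    have h : RepeatedMatching.randomizedReward G p T w OPT ≤
        RepeatedMatching.expectedReward G p T w a / 0.316 :=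
      RepeatedMatching.tsum_pmf_mul_le OPT
        (RepeatedMatching.expectedReward_nonneg hp hw) fun b => by
          rw [le_div_iff₀' (by norm_num)]
          exact RepeatedMatching.expectedReward_stable_ge hp hw (hSM a ha) b
    rwa [le_div_iff₀' (by norm_num)] at h
  exact RepeatedMatching.le_tsum_pmf_mul SM (RepeatedMatching.expectedReward_nonneg hp hw)
    (RepeatedMatching.expectedReward_le hp hw) hb
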